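/- Conventions. A pair of jointly distributed random variables $X\in\{0,1\}^n$, $Z\in\{0,1\}^m$ has conditional min-entropy $\mathbf{H}_\infty(X|Z)\ge k$ if $\Pr[X=x\mid Z=z]\le 2^{-k}$ for all $x$ and all $z$ with $\Pr[Z=z]>0$. It has smooth conditional min-entropy $\mathbf{H}^{\delta}_\infty(X|Z)\ge k$ if there is a pair $(Y,Z')$ on $\{0,1\}^n\times\{0,1\}^m$ at statistical distance $\frac12\sum_{x,z}|\Pr[(X,Z)=(x,z)]-\Pr[(Y,Z')=(x,z)]|\le\delta$ from $(X,Z)$ with $\mathbf{H}_\infty(Y|Z')\ge k$; and $\mathbf{H}^{\delta}_\infty(X|Z)\le b$ means that $\mathbf{H}^{\delta}_\infty(X|Z)\ge t$ holds for no $t>b$. For real $s$, it has metric conditional min-entropy $\mathbf{H}^{\mathrm{Metric},\det[0,1],s,\epsilon}(X|Z)\ge k$ if for every deterministic $[0,1]$-valued circuit $D$ of size at most $s$ on $n+m$ input bits there is a pair $(Y,Z)$ with the same distribution of $Z$ such that $\mathbf{H}_\infty(Y|Z)\ge k$ and $|\mathbf{E}D(X,Z)-\mathbf{E}D(Y,Z)|\le\epsilon$.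 Circuits have gates of fan-in two computing arbitrary binary Boolean operations; the size is the number of vertices, the $n+m$ input vertices included; a $[0,1]$-valued circuit outputs the binary digits of its value $b_0.b_1\cdots b_r\in[0,1]$, for any $r\ge 0$. Theorem. There are an absolute constant $c>0$ and an $n_0$ such that for all integers $n\ge n_0$ and $m\ge 0$ and all real $C>0$, $0\le k<n-C$ and $\epsilon>0$ with $2^{k+m}\epsilon^2\ge 2$ there is a pair of jointly distributed random variables $X\in\{0,1\}^n$, $Z\in\{0,1\}^m$ such that (i) $\mathbf{H}^{1/2}_\infty(X|Z)\le k+1$, and (ii) $\mathbf{H}^{\mathrm{Metric},\det[0,1],s,\epsilon}(X|Z)\ge k+C$ for $s=c\cdot\dfrac{2^{k+m}\epsilon^4}{(k+m)\log_2\left(2^{k+m}\epsilon^2\right)}$. -/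

import Mathlib

open scoped BigOperators

noncomputable section

/-- Bit strings of length `n`. -/
abbrev Bits (n : ℕ) : Type := Fin n → Bool

/-! ### Information-theoretic notions

A pair of jointly distributed random variables `X ∈ {0,1}^n`, `Z ∈ {0,1}^m` is given by its joint
law, a `PMF (Bits n × Bits m)`. -/

/-- The expectation of `f` under a law on a finite set. -/
def expect {α : Type} [Fintype α] (P : PMF α) (f : α → ℝ) : ℝ :=
  ∑ a, (P a).toReal * f a

/-- Statistical distance `Δ(P, Q) = (1/2) ∑ₐ |P(a) - Q(a)|`. -/
def statDist {α : Type} [Fintype α] (P Q : PMF α) : ℝ :=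
  (1 / 2) * ∑ a, |(P a).toReal - (Q a).toReal|

/-- The law of `Z`, where `P` is the law of `(X, Z)`. -/
def condLaw {n m : ℕ} (P : PMF (Bits n × Bits m)) : PMF (Bits m) :=
  P.map Prod.snd

/-- Worst-case conditional min-entropy, `H_∞(X|Z) ≥ k`: for every value `z` that `Z` attains with
positive probability and every `x`, `Pr[X = x | Z = z] ≤ 2^{-k}`. -/
def CondMinEntropyAtLeast {n m : ℕ} (P : PMF (Bits n × Bits m)) (k : ℝ) : Prop :=
  ∀ z, condLaw P z ≠ 0 →
    ∀ x, (P (x, z)).toReal / (condLaw P z).toReal ≤ (2 : ℝ) ^ (-k)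

/-- Smooth conditional min-entropy, `H_∞^ε(X|Z) ≥ k`: some joint law at statistical distance at
most `ε` from that of `(X, Z)` has conditional min-entropy at least `k`. The law of the second
component may change too, so an upper bound on this entropy is also an upper bound on the
variant in which it is kept. -/
def SmoothCondMinEntropyAtLeast {n m : ℕ} (P : PMF (Bits n × Bits m)) (ε k : ℝ) : Prop :=
  ∃ Q : PMF (Bits n × Bits m), CondMinEntropyAtLeast Q k ∧ statDist P Q ≤ ε

/-- `H_∞^ε(X|Z) ≤ b`: the smooth conditional min-entropy is at least `t` for no `t > b`. -/
def SmoothCondMinEntropyAtMost {n m : ℕ} (P : PMF (Bits n × Bits m)) (ε b : ℝ) : Prop :=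
  ∀ t : ℝ, SmoothCondMinEntropyAtLeast P ε t → t ≤ b

/-- Metric conditional min-entropy at least `k` against the class `𝒟` with advantage `ε`: for
every `D ∈ 𝒟` there is a pair `(Y, Z)`, with the same `Z`, such that `H_∞(Y|Z) ≥ k` and
`|E D(X,Z) - E D(Y,Z)| ≤ ε`. -/
def MetricCondMinEntropyAtLeast {n m : ℕ} (P : PMF (Bits n × Bits m))
    (𝒟 : Set (Bits n × Bits m → ℝ)) (ε k : ℝ) : Prop :=
  ∀ D ∈ 𝒟, ∃ Q : PMF (Bits n × Bits m),
    condLaw Q = condLaw P ∧ CondMinEntropyAtLeast Q k ∧ |expect P D - expect Q D| ≤ ε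

/-! ### Circuits -/

/-- Boolean circuits with `N` input vertices and `v` vertices in all, the vertices listed in a
topological order: first the inputs, then the gates. A gate applies an arbitrary binary Boolean
operation to two earlier vertices (this includes constants, negation, conjunction and
disjunction). The size of the circuit is its number `v` of vertices. -/
inductive Circuit (N : ℕ) : ℕ → Type
  | inputs : Circuit N N
  | gate {v : ℕ} (c : Circuit N v) (op : Bool → Bool → Bool) (i j : Fin v) : Circuit N (v + 1)

/-- The bit computed at each vertex of the circuit. -/
def Circuit.eval {N : ℕ} : {v : ℕ} → Circuit N v → Bits N → Bits v
  | _, .inputs, w => w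
  | _, .gate c op i j, w => Fin.snoc (c.eval w) (op (c.eval w i) (c.eval w j))

/-- The number with binary expansion `b₀.b₁b₂…b_r`. -/
def binaryValue {r : ℕ} (b : Fin (r + 1) → Bool) : ℝ :=
  ∑ i, if b i then ((1 : ℝ) / 2) ^ (i : ℕ) else 0

/-- The functions on `{0,1}^n × {0,1}^m` computed by deterministic `[0,1]`-valued circuits of size
at most `s`: a circuit reads the `n + m` input bits, its output vertices give the digits of the
value in binary, and that value lies in `[0,1]` on every input. With a single output vertex
(`r = 0`) these are the Boolean circuits. -/
def realValuedCircuits (n m : ℕ) (s : ℝ) : Set (Bits n × Bits m → ℝ) :=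
  {D | ∃ (v : ℕ) (c : Circuit (n + m) v) (r : ℕ) (out : Fin (r + 1) → Fin v),
    (v : ℝ) ≤ s ∧
    (∀ p : Bits n × Bits m,
      D p = binaryValue (fun i => c.eval (Fin.append p.1 p.2) (out i))) ∧
    ∀ p, D p ∈ Set.Icc (0 : ℝ) 1}

end

/-!
Give each `z` a list of about `2 ^ k` independent uniform samples from `{0,1}^n`, and let `X` be
uniform on the list of `Z`, for uniform `Z`. The fibres of the support of `(X, Z)` have at most
`2 ^ k` points, so a law close to it has conditional min-entropy not much above `k`.

On the other hand the advantage of a fixed Boolean test in telling `(X, Z)` from the uniform law is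
an average of about `2 ^ (k + m)` independent centred variables with values in an interval of length
one, so Hoeffding's inequality makes it exceed `ε / 2` with probability at most
`2 exp (-Ω(2 ^ (k + m) ε ^ 2))`. Circuits with `V` vertices compute only `2 ^ O(V log V)` Boolean
functions, and a union bound yields samples that fool all of them. The digits of a real-valued
circuit have total weight at most two, so its advantage is then at most `ε`, and the uniform law
witnesses the metric entropy.
-/

open MeasureTheory ProbabilityTheory

/-! ### Laws on finite sets -/

section FiniteLaws

variable {α β : Type} [Fintype α] [Fintype β]

lemma sum_pmf_toReal (P : PMF α) : ∑ a, (P a).toReal = 1 := by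
  rw [← ENNReal.toReal_sum fun a _ => P.apply_ne_top a, ← tsum_fintype (L := .unconditional α),
    P.tsum_coe, ENNReal.toReal_one]

lemma expect_eq_integral [MeasurableSpace α] [MeasurableSingletonClass α] (P : PMF α)
    (f : α → ℝ) : expect P f = ∫ a, f a ∂P.toMeasure :=
  (PMF.integral_eq_sum P f).symm

lemma expect_map (P : PMF α) (g : α → β) (f : β → ℝ) :
    expect (P.map g) f = expect P fun a => f (g a) := by
  let _ : MeasurableSpace α := ⊤
  let _ : MeasurableSpace β := ⊤
  rw [expect_eq_integral, expect_eq_integral, ← PMF.toMeasure_map g P (measurable_of_finite g),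
    integral_map (measurable_of_finite g).aemeasurable
      (measurable_of_finite f).aestronglyMeasurable]

lemma expect_sub (P : PMF α) (f g : α → ℝ) :
    expect P (fun a => f a - g a) = expect P f - expect P g := by
  simp only [expect, mul_sub, Finset.sum_sub_distrib]

lemma expect_uniformOfFintype [Nonempty α] (f : α → ℝ) :
    expect (PMF.uniformOfFintype α) f = (∑ a, f a) / Fintype.card α := by
  simp [expect, div_eq_inv_mul, Finset.mul_sum]

lemma expect_mem_Icc (P : PMF α) {f : α → ℝ} {a b : ℝ} (hf : ∀ x, f x ∈ Set.Icc a b) :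
    expect P f ∈ Set.Icc a b := by
  have hconst (y : ℝ) : y = ∑ x, (P x).toReal * y := by
    rw [← Finset.sum_mul, sum_pmf_toReal, one_mul]
  rw [Set.mem_Icc, hconst a, hconst b]
  exact ⟨Finset.sum_le_sum fun x _ => mul_le_mul_of_nonneg_left (hf x).1 ENNReal.toReal_nonneg,
    Finset.sum_le_sum fun x _ => mul_le_mul_of_nonneg_left (hf x).2 ENNReal.toReal_nonneg⟩

lemma sum_sub_sum_le_statDist (P Q : PMF α) (S : Finset α) :
    ∑ a ∈ S, (P a).toReal - ∑ a ∈ S, (Q a).toReal ≤ statDist P Q := by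
  classical
  have hcompl : ∑ a ∈ S, ((P a).toReal - (Q a).toReal) =
      -∑ a ∈ Sᶜ, ((P a).toReal - (Q a).toReal) := by
    rw [eq_neg_iff_add_eq_zero, Finset.sum_add_sum_compl, Finset.sum_sub_distrib,
      sum_pmf_toReal, sum_pmf_toReal, sub_self]
  have hS := Finset.abs_sum_le_sum_abs (fun a => (P a).toReal - (Q a).toReal) S
  have hSc := Finset.abs_sum_le_sum_abs (fun a => (P a).toReal - (Q a).toReal) Sᶜ
  rw [← Finset.sum_sub_distrib, statDist, ← Finset.sum_add_sum_compl S]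
  linarith [le_abs_self (∑ a ∈ S, ((P a).toReal - (Q a).toReal)),
    neg_le_abs (∑ a ∈ Sᶜ, ((P a).toReal - (Q a).toReal))]

lemma map_snd_uniformOfFintype [Nonempty α] [Nonempty β] :
    (PMF.uniformOfFintype (α × β)).map Prod.snd = PMF.uniformOfFintype β := by
  classical
  ext b
  have hα : (Fintype.card α : ENNReal) ≠ 0 := by simp
  rw [PMF.map_apply, tsum_fintype, Fintype.sum_prod_type]
  simp only [PMF.uniformOfFintype_apply, Fintype.card_prod, Nat.cast_mul, Finset.sum_ite_eq,
    Finset.mem_univ, if_true, Finset.sum_const, Finset.card_univ, nsmul_eq_mul]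
  rw [ENNReal.mul_inv (.inl hα) (.inl (ENNReal.natCast_ne_top _)), ← mul_assoc,
    ENNReal.mul_inv_cancel hα (ENNReal.natCast_ne_top _), one_mul]

lemma expect_uniformOfFintype_prod [Nonempty α] [Nonempty β] (f : α × β → ℝ) :
    expect (PMF.uniformOfFintype (α × β)) f =
      expect (PMF.uniformOfFintype β) fun b =>
        expect (PMF.uniformOfFintype α) fun a => f (a, b) := by
  simp only [expect_uniformOfFintype, Fintype.sum_prod_type_right, Fintype.card_prod,
    ← Finset.sum_div, div_div, Nat.cast_mul]

end FiniteLaws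

/-! ### Conditional min-entropy -/

section MinEntropy

variable {n m : ℕ}

lemma CondMinEntropyAtLeast.mono {P : PMF (Bits n × Bits m)} {k l : ℝ}
    (h : CondMinEntropyAtLeast P k) (hlk : l ≤ k) : CondMinEntropyAtLeast P l :=
  fun z hz x => (h z hz x).trans
    (Real.rpow_le_rpow_of_exponent_le one_le_two (neg_le_neg hlk))

lemma MetricCondMinEntropyAtLeast.mono {P : PMF (Bits n × Bits m)}
    {𝒟 : Set (Bits n × Bits m → ℝ)} {ε k l : ℝ}
    (h : MetricCondMinEntropyAtLeast P 𝒟 ε k) (hlk : l ≤ k) :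
    MetricCondMinEntropyAtLeast P 𝒟 ε l := fun D hD =>
  let ⟨Q, hQP, hQ, hDQ⟩ := h D hD
  ⟨Q, hQP, hQ.mono hlk, hDQ⟩

lemma CondMinEntropyAtLeast.toReal_apply_le {Q : PMF (Bits n × Bits m)} {k : ℝ}
    (hQ : CondMinEntropyAtLeast Q k) (x : Bits n) (z : Bits m) :
    (Q (x, z)).toReal ≤ (2 : ℝ) ^ (-k) * (condLaw Q z).toReal := by
  by_cases hz : condLaw Q z = 0
  · have hxz : Q (x, z) = 0 := by
      simp only [condLaw, PMF.map_apply, ENNReal.tsum_eq_zero] at hz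
      simpa using hz (x, z)
    simp [hxz, hz]
  · exact (div_le_iff₀ (ENNReal.toReal_pos hz (PMF.apply_ne_top _ _))).1 (hQ z hz x)

lemma condMinEntropyAtLeast_uniformOfFintype :
    CondMinEntropyAtLeast (PMF.uniformOfFintype (Bits n × Bits m)) n := by
  intro z _ x
  rw [condLaw, map_snd_uniformOfFintype, Real.rpow_neg zero_le_two, Real.rpow_natCast]
  refine le_of_eq ?_
  simp only [PMF.uniformOfFintype_apply, Fintype.card_prod, Fintype.card_pi, Fintype.card_bool,
    Finset.prod_const, Finset.card_univ, Fintype.card_fin, Nat.cast_mul, Nat.cast_pow,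
    Nat.cast_ofNat, ENNReal.toReal_inv, ENNReal.toReal_mul, ENNReal.toReal_pow,
    ENNReal.toReal_ofNat]
  field_simp

lemma metricCondMinEntropyAtLeast_of_uniformOfFintype {P : PMF (Bits n × Bits m)}
    {𝒟 : Set (Bits n × Bits m → ℝ)} {ε : ℝ}
    (hP : condLaw P = PMF.uniformOfFintype (Bits m))
    (h𝒟 : ∀ D ∈ 𝒟, |expect P D - expect (PMF.uniformOfFintype (Bits n × Bits m)) D| ≤ ε) :
    MetricCondMinEntropyAtLeast P 𝒟 ε n := fun D hD =>
  ⟨PMF.uniformOfFintype _, map_snd_uniformOfFintype.trans hP.symm,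
    condMinEntropyAtLeast_uniformOfFintype, h𝒟 D hD⟩

lemma CondMinEntropyAtLeast.sum_toReal_le {Q : PMF (Bits n × Bits m)} {t B : ℝ}
    (hQ : CondMinEntropyAtLeast Q t) (S : Finset (Bits n × Bits m))
    (hS : ∀ z, (({x | (x, z) ∈ S} : Finset (Bits n)).card : ℝ) ≤ B) :
    ∑ a ∈ S, (Q a).toReal ≤ B * (2 : ℝ) ^ (-t) := by
  calc ∑ a ∈ S, (Q a).toReal
      = ∑ z, ∑ x with (x, z) ∈ S, (Q (x, z)).toReal := by
        simp only [Finset.sum_filter]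
        rw [← Fintype.sum_prod_type_right fun a => if a ∈ S then (Q a).toReal else 0]
        simp
    _ ≤ ∑ z, B * ((2 : ℝ) ^ (-t) * (condLaw Q z).toReal) := by
        refine Finset.sum_le_sum fun z _ => ?_
        refine (Finset.sum_le_card_nsmul _ _ _ fun x _ => hQ.toReal_apply_le x z).trans ?_
        rw [nsmul_eq_mul]
        exact mul_le_mul_of_nonneg_right (hS z) (by positivity)
    _ = B * (2 : ℝ) ^ (-t) := by
        rw [← Finset.mul_sum, ← Finset.mul_sum, sum_pmf_toReal, mul_one]

lemma smoothCondMinEntropyAtMost_of_card_fiber_le {P : PMF (Bits n × Bits m)} {k δ : ℝ}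
    (hP : ∀ z, (({x | P (x, z) ≠ 0} : Finset (Bits n)).card : ℝ) ≤ 2 ^ k) (hδ : δ < 1) :
    SmoothCondMinEntropyAtMost P δ (k - Real.logb 2 (1 - δ)) := by
  rintro t ⟨Q, hQ, hPQ⟩
  set S : Finset (Bits n × Bits m) := {a | P a ≠ 0}
  have hPS : ∑ a ∈ S, (P a).toReal = 1 := by
    rw [← sum_pmf_toReal P]
    refine Finset.sum_subset (Finset.subset_univ S) fun a _ ha => ?_
    simp_all [S]
  have hQS : ∑ a ∈ S, (Q a).toReal ≤ (2 : ℝ) ^ (k - t) := by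
    rw [sub_eq_add_neg, Real.rpow_add two_pos]
    exact hQ.sum_toReal_le S (by simpa [S] using hP)
  have hmass : 1 - δ ≤ (2 : ℝ) ^ (k - t) := by
    linarith [sum_sub_sum_le_statDist P Q S]
  linarith [(Real.logb_le_iff_le_rpow one_lt_two (sub_pos.2 hδ)).2 hmass]

end MinEntropy

/-! ### Concentration -/

section Concentration

lemma measureReal_le_abs_le_of_hasSubgaussianMGF {Ω : Type*} [MeasurableSpace Ω] {μ : Measure Ω}
    {X : Ω → ℝ} {c : NNReal} (hX : HasSubgaussianMGF X c μ) {ε : ℝ} (hε : 0 ≤ ε) :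
    μ.real {ω | ε ≤ |X ω|} ≤ 2 * Real.exp (-ε ^ 2 / (2 * c)) := by
  have hunion : {ω | ε ≤ |X ω|} = {ω | ε ≤ X ω} ∪ {ω | ε ≤ (-X) ω} := by
    ext ω
    simp only [Set.mem_ofPred_eq, Set.mem_union, Pi.neg_apply, le_abs]
  rw [hunion, two_mul]
  exact (measureReal_union_le _ _).trans
    (add_le_add (hX.measure_ge_le hε) (hX.neg.measure_ge_le hε))

lemma exists_forall_abs_lt_of_hasSubgaussianMGF {Ω J : Type*} [MeasurableSpace Ω]
    {μ : Measure Ω} [IsProbabilityMeasure μ] (F : Finset J) {X : J → Ω → ℝ} {c : NNReal}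
    (hX : ∀ j ∈ F, HasSubgaussianMGF (X j) c μ) {ε : ℝ} (hε : 0 ≤ ε)
    (hF : F.card * (2 * Real.exp (-ε ^ 2 / (2 * c))) < 1) :
    ∃ ω, ∀ j ∈ F, |X j ω| < ε := by
  by_contra! hcover
  refine hF.not_ge ?_
  calc (1 : ℝ) = μ.real (⋃ j ∈ F, {ω | ε ≤ |X j ω|}) := by
        rw [← probReal_univ (μ := μ)]
        congr 1
        exact (Set.eq_univ_of_forall fun ω => by simpa using hcover ω).symm
    _ ≤ ∑ j ∈ F, μ.real {ω | ε ≤ |X j ω|} := measureReal_biUnion_finset_le _ _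
    _ ≤ F.card * (2 * Real.exp (-ε ^ 2 / (2 * c))) := by
        rw [← nsmul_eq_mul]
        exact Finset.sum_le_card_nsmul _ _ _ fun j hj =>
          measureReal_le_abs_le_of_hasSubgaussianMGF (hX j hj) hε

lemma hasSubgaussianMGF_pi_sum_sub_integral {ι : Type*} [Fintype ι] {Ω : ι → Type*}
    [∀ i, MeasurableSpace (Ω i)] {μ : ∀ i, Measure (Ω i)} [∀ i, IsProbabilityMeasure (μ i)]
    {f : ∀ i, Ω i → ℝ} {a b : ι → ℝ} (hf : ∀ i, AEMeasurable (f i) (μ i))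
    (hfab : ∀ i, ∀ᵐ x ∂μ i, f i x ∈ Set.Icc (a i) (b i)) :
    HasSubgaussianMGF (fun ω => ∑ i, (f i (ω i) - ∫ x, f i x ∂μ i))
      (∑ i, (‖b i - a i‖₊ / 2) ^ 2) (Measure.pi μ) := by
  refine HasSubgaussianMGF.sum_of_iIndepFun
    (iIndepFun_pi (X := fun i x => f i x - ∫ y, f i y ∂μ i) fun i => (hf i).sub_const _)
    fun i _ => ?_
  have hmp := measurePreserving_eval μ i
  have hi := hasSubgaussianMGF_of_mem_Icc (hf i) (hfab i)
  rw [← hmp.map_eq] at hi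
  have hi' := hi.of_map hmp.measurable.aemeasurable
  rwa [hmp.map_eq] at hi'

end Concentration

/-! ### The law of a sample -/

section SampleLaw

variable {κ α β : Type} [Fintype κ] [Nonempty κ] [Fintype β] [Nonempty β]

/-- The law of `(x (J, Z), Z)` for uniform and independent `J` and `Z`: given `Z = z`, the first
component is uniform on the list of samples `x (j, z)`, with multiplicity. -/
noncomputable def sampleLaw (x : κ × β → α) : PMF (α × β) :=
  (PMF.uniformOfFintype (κ × β)).map fun p => (x p, p.2)

lemma condLaw_sampleLaw {n m : ℕ} (x : κ × Bits m → Bits n) :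
    condLaw (sampleLaw x) = PMF.uniformOfFintype (Bits m) := by
  rw [condLaw, sampleLaw, PMF.map_comp]
  exact map_snd_uniformOfFintype

lemma card_fiber_sampleLaw_le [Fintype α] (x : κ × β → α) (b : β) :
    ({a | sampleLaw x (a, b) ≠ 0} : Finset α).card ≤ Fintype.card κ := by
  classical
  calc ({a | sampleLaw x (a, b) ≠ 0} : Finset α).card
      ≤ (Finset.univ.image fun j => x (j, b)).card := by
        refine Finset.card_le_card fun a ha => ?_
        rw [Finset.mem_filter, ← PMF.mem_support_iff, sampleLaw, PMF.support_map] at ha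
        obtain ⟨-, ⟨j, b'⟩, -, hab⟩ := ha
        obtain ⟨rfl, rfl⟩ := Prod.mk.inj hab
        exact Finset.mem_image_of_mem _ (Finset.mem_univ j)
    _ ≤ Fintype.card κ := Finset.card_image_le

variable [Fintype α] [Nonempty α]

lemma sum_sub_expect_eq_card_mul (x : κ × β → α) (f : α × β → ℝ) :
    ∑ p : κ × β, (f (x p, p.2) - expect (PMF.uniformOfFintype α) fun a => f (a, p.2)) =
      Fintype.card (κ × β) *
        (expect (sampleLaw x) f - expect (PMF.uniformOfFintype (α × β)) f) := by
  rw [expect_uniformOfFintype_prod, ← map_snd_uniformOfFintype (α := κ) (β := β), sampleLaw,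
    expect_map, expect_map, ← expect_sub, expect_uniformOfFintype,
    mul_div_cancel₀ _ (by exact_mod_cast Fintype.card_ne_zero)]

lemma exists_sampleLaw_forall_abs_expect_sub_le {J : Type*} (F : Finset J)
    {f : J → α × β → ℝ} (hf : ∀ j ∈ F, ∀ p, f j p ∈ Set.Icc (0 : ℝ) 1) {δ : ℝ} (hδ : 0 ≤ δ)
    (hF : F.card * (2 * Real.exp (-(2 * Fintype.card (κ × β) * δ ^ 2))) < 1) :
    ∃ x : κ × β → α, ∀ j ∈ F,
      |expect (sampleLaw x) (f j) - expect (PMF.uniformOfFintype (α × β)) (f j)| ≤ δ := by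
  let _ : MeasurableSpace α := ⊤
  set N : ℝ := (Fintype.card (κ × β) : ℝ) with hN
  have hN0 : 0 < N := Nat.cast_pos.2 Fintype.card_pos
  have hsubG (j : J) (hj : j ∈ F) := hasSubgaussianMGF_pi_sum_sub_integral (ι := κ × β)
    (μ := fun _ => (PMF.uniformOfFintype α).toMeasure) (f := fun p a => f j (a, p.2))
    (a := 0) (b := 1) (fun _ => (measurable_of_finite _).aemeasurable)
    (fun p => .of_forall fun a => hf j hj (a, p.2))
  obtain ⟨x, hx⟩ := exists_forall_abs_lt_of_hasSubgaussianMGF F hsubG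
    (mul_nonneg hN0.le hδ) (by
      convert hF using 4
      simp only [hN, Fintype.card_prod, Pi.one_apply, Pi.zero_apply, sub_zero, nnnorm_one,
        Finset.sum_const, Finset.card_univ, nsmul_eq_mul]
      push_cast
      field_simp)
  refine ⟨x, fun j hj => ?_⟩
  have hxj := (hx j hj).le
  simp only [← expect_eq_integral] at hxj
  rw [sum_sub_expect_eq_card_mul, ← hN, abs_mul, abs_of_pos hN0] at hxj
  exact le_of_mul_le_mul_left hxj hN0

end SampleLaw

/-! ### Counting circuits -/

section Counting

lemma Circuit.inputs_le_size {N v : ℕ} (c : Circuit N v) : N ≤ v := by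
  induction c with
  | inputs => exact le_rfl
  | gate _ _ _ _ ih => exact ih.trans (Nat.le_succ _)

lemma Circuit.range_eval_self (N : ℕ) :
    Set.range (Circuit.eval : Circuit N N → Bits N → Bits N) = {id} := by
  refine Set.eq_singleton_iff_unique_mem.2 ⟨⟨.inputs, rfl⟩, ?_⟩
  rintro _ ⟨c, rfl⟩
  cases c with
  | inputs => rfl
  | gate c _ _ _ => exact absurd c.inputs_le_size (by omega)

lemma Circuit.ncard_range_eval_succ_le {N v : ℕ} (hv : N ≤ v) :
    (Set.range (Circuit.eval : Circuit N (v + 1) → Bits N → Bits (v + 1))).ncard ≤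
      (Set.range (Circuit.eval : Circuit N v → Bits N → Bits v)).ncard * (16 * v ^ 2) := by
  set E := Set.range (Circuit.eval : Circuit N v → Bits N → Bits v)
  let addGate (q : (Bits N → Bits v) × (Bool → Bool → Bool) × Fin v × Fin v) :
      Bits N → Bits (v + 1) :=
    fun w => Fin.snoc (q.1 w) (q.2.1 (q.1 w q.2.2.1) (q.1 w q.2.2.2))
  have hsub : Set.range (Circuit.eval : Circuit N (v + 1) → _) ⊆ addGate '' (E ×ˢ Set.univ) := by
    rintro _ ⟨c, rfl⟩
    cases c with
    | inputs => omega
    | gate c op i j => exact ⟨(c.eval, op, i, j), ⟨⟨c, rfl⟩, trivial⟩, rfl⟩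
  refine (Set.ncard_le_ncard hsub).trans ((Set.ncard_image_le (Set.toFinite _)).trans_eq ?_)
  rw [Set.ncard_prod, Set.ncard_univ, Nat.card_eq_fintype_card]
  simp [sq]

lemma Circuit.ncard_range_eval_le (N v : ℕ) :
    (Set.range (Circuit.eval : Circuit N v → Bits N → Bits v)).ncard ≤ (16 * v ^ 2) ^ v := by
  rcases lt_or_ge v N with hv | hv
  · have : IsEmpty (Circuit N v) := ⟨fun c => hv.not_ge c.inputs_le_size⟩
    simp [Set.range_eq_empty]
  · induction v, hv using Nat.le_induction with
    | base =>
      rw [Circuit.range_eval_self, Set.ncard_singleton]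
      rcases N.eq_zero_or_pos with rfl | hN
      · simp
      · exact Nat.one_le_pow _ _ (by positivity)
    | succ v hv ih =>
      calc _ ≤ (16 * v ^ 2) ^ v * (16 * v ^ 2) :=
            (ncard_range_eval_succ_le hv).trans (Nat.mul_le_mul_right _ ih)
        _ = (16 * v ^ 2) ^ (v + 1) := (pow_succ _ _).symm
        _ ≤ (16 * (v + 1) ^ 2) ^ (v + 1) := by gcongr; omega

/-- The Boolean functions computed at the vertices of circuits with `N` inputs and exactly `V`
vertices. -/
def vertexFunctions (N V : ℕ) : Set (Bits N → Bool) :=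
  {f | ∃ (c : Circuit N V) (i : Fin V), f = fun w => c.eval w i}

lemma vertexFunctions_subset_succ (N V : ℕ) :
    vertexFunctions N V ⊆ vertexFunctions N (V + 1) := by
  rintro _ ⟨c, i, rfl⟩
  exact ⟨c.gate (fun _ _ => false) i i, i.castSucc,
    funext fun w => (Fin.snoc_castSucc (α := fun _ => Bool) _ _ _).symm⟩

lemma vertexFunctions_mono (N : ℕ) : Monotone (vertexFunctions N) :=
  monotone_nat_of_le_succ (vertexFunctions_subset_succ N)

lemma ncard_vertexFunctions_le (N V : ℕ) :
    (vertexFunctions N V).ncard ≤ (16 * V ^ 2) ^ V * V := by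
  have hsub : vertexFunctions N V ⊆
      (fun q : (Bits N → Bits V) × Fin V => fun w => q.1 w q.2) ''
        (Set.range (Circuit.eval : Circuit N V → _) ×ˢ Set.univ) := by
    rintro _ ⟨c, i, rfl⟩
    exact ⟨(c.eval, i), ⟨⟨c, rfl⟩, trivial⟩, rfl⟩
  refine (Set.ncard_le_ncard hsub).trans ((Set.ncard_image_le (Set.toFinite _)).trans ?_)
  rw [Set.ncard_prod, Set.ncard_univ, Nat.card_eq_fintype_card, Fintype.card_fin]
  exact Nat.mul_le_mul_right _ (Circuit.ncard_range_eval_le N V)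

lemma two_mul_ncard_vertexFunctions_le (N V : ℕ) :
    2 * (vertexFunctions N V).ncard ≤ (16 * V) ^ (2 * V) := by
  have hV : 2 * V ≤ 16 ^ V :=
    calc 2 * V ≤ 2 ^ V * 2 ^ V := by nlinarith [V.lt_two_pow_self, Nat.one_le_two_pow (n := V)]
      _ = 4 ^ V := by rw [← mul_pow]; norm_num
      _ ≤ 16 ^ V := Nat.pow_le_pow_left (by norm_num) V
  calc 2 * (vertexFunctions N V).ncard ≤ 2 * V * (16 * V ^ 2) ^ V := by
        linarith [ncard_vertexFunctions_le N V]
    _ ≤ 16 ^ V * (16 * V ^ 2) ^ V := Nat.mul_le_mul_right _ hV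
    _ = (16 * V) ^ (2 * V) := by rw [← mul_pow, pow_mul]; ring

end Counting

/-! ### Real-valued circuits -/

section RealValuedCircuits

variable {n m : ℕ}

/-- A Boolean function of the concatenated input bits, as a `0`-`1`-valued test on pairs. -/
def boolTest (f : Bits (n + m) → Bool) (p : Bits n × Bits m) : ℝ :=
  if f (Fin.append p.1 p.2) then 1 else 0

lemma boolTest_mem_Icc (f : Bits (n + m) → Bool) (p : Bits n × Bits m) :
    boolTest f p ∈ Set.Icc (0 : ℝ) 1 := by
  unfold boolTest
  split_ifs <;> simp

lemma abs_expect_sub_le_one_of_mem_realValuedCircuits {s : ℝ} {D : Bits n × Bits m → ℝ}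
    (hD : D ∈ realValuedCircuits n m s) (P Q : PMF (Bits n × Bits m)) :
    |expect P D - expect Q D| ≤ 1 := by
  obtain ⟨-, -, -, -, -, -, hD01⟩ := hD
  have hP := expect_mem_Icc P hD01
  have hQ := expect_mem_Icc Q hD01
  rw [abs_le]
  constructor <;> linarith [hP.1, hP.2, hQ.1, hQ.2]

lemma abs_expect_sub_le_of_forall_vertexFunctions {s δ : ℝ} {P Q : PMF (Bits n × Bits m)}
    (hδ : 0 ≤ δ)
    (hPQ : ∀ f ∈ vertexFunctions (n + m) ⌊s⌋₊,
      |expect P (boolTest f) - expect Q (boolTest f)| ≤ δ)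
    {D : Bits n × Bits m → ℝ} (hD : D ∈ realValuedCircuits n m s) :
    |expect P D - expect Q D| ≤ 2 * δ := by
  obtain ⟨v, c, r, out, hv, hDc, -⟩ := hD
  let f (i : Fin (r + 1)) : Bits (n + m) → Bool := fun w => c.eval w (out i)
  have hf (i : Fin (r + 1)) : f i ∈ vertexFunctions (n + m) ⌊s⌋₊ :=
    vertexFunctions_mono _ (Nat.le_floor hv) ⟨c, out i, rfl⟩
  have hexpand (R : PMF (Bits n × Bits m)) :
      expect R D = ∑ i : Fin (r + 1), ((1 : ℝ) / 2) ^ (i : ℕ) * expect R (boolTest (f i)) := by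
    simp only [expect, hDc, binaryValue, Finset.mul_sum]
    rw [Finset.sum_comm]
    refine Finset.sum_congr rfl fun i _ => Finset.sum_congr rfl fun p _ => ?_
    simp only [boolTest, f]
    split_ifs <;> ring
  calc |expect P D - expect Q D|
      = |∑ i : Fin (r + 1), ((1 : ℝ) / 2) ^ (i : ℕ) *
          (expect P (boolTest (f i)) - expect Q (boolTest (f i)))| := by
        simp only [hexpand, mul_sub, Finset.sum_sub_distrib]
    _ ≤ ∑ i : Fin (r + 1), ((1 : ℝ) / 2) ^ (i : ℕ) * δ := by
        refine (Finset.abs_sum_le_sum_abs _ _).trans (Finset.sum_le_sum fun i _ => ?_)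
        rw [abs_mul, abs_of_nonneg (by positivity)]
        exact mul_le_mul_of_nonneg_left (hPQ _ (hf i)) (by positivity)
    _ ≤ 2 * δ := by
        rw [← Finset.sum_mul, Fin.sum_univ_eq_sum_range (fun i => ((1 : ℝ) / 2) ^ i)]
        exact mul_le_mul_of_nonneg_right (sum_geometric_two_le _) hδ

lemma exists_sampleLaw_forall_realValuedCircuits {κ : Type} [Fintype κ] [Nonempty κ] {s ε : ℝ}
    (hε : 0 ≤ ε)
    (hs : (16 * ⌊s⌋₊ : ℝ) ^ (2 * ⌊s⌋₊) *
      Real.exp (-(Fintype.card (κ × Bits m) * ε ^ 2 / 2)) < 1) :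
    ∃ x : κ × Bits m → Bits n, ∀ D ∈ realValuedCircuits n m s,
      |expect (sampleLaw x) D - expect (PMF.uniformOfFintype (Bits n × Bits m)) D| ≤ ε := by
  set F := (vertexFunctions (n + m) ⌊s⌋₊).toFinite.toFinset with hF
  have hcard : 2 * (F.card : ℝ) ≤ (16 * ⌊s⌋₊ : ℝ) ^ (2 * ⌊s⌋₊) := by
    rw [hF, ← Set.ncard_eq_toFinset_card]
    exact_mod_cast two_mul_ncard_vertexFunctions_le (n + m) ⌊s⌋₊
  obtain ⟨x, hx⟩ := exists_sampleLaw_forall_abs_expect_sub_le (κ := κ) F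
    (fun f _ p => boolTest_mem_Icc f p) (by positivity)
    (calc F.card * (2 * Real.exp (-(2 * Fintype.card (κ × Bits m) * (ε / 2) ^ 2)))
        = 2 * F.card * Real.exp (-(Fintype.card (κ × Bits m) * ε ^ 2 / 2)) := by ring_nf
      _ ≤ (16 * ⌊s⌋₊ : ℝ) ^ (2 * ⌊s⌋₊) *
          Real.exp (-(Fintype.card (κ × Bits m) * ε ^ 2 / 2)) := by gcongr
      _ < 1 := hs)
  refine ⟨x, fun D hD => ?_⟩
  calc _ ≤ 2 * (ε / 2) := abs_expect_sub_le_of_forall_vertexFunctions (by positivity)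
        (fun f hf => hx f ((Set.Finite.mem_toFinset _).2 hf)) hD
    _ = ε := by ring

end RealValuedCircuits

/-! ### The size bound -/

lemma pow_mul_exp_lt_one {V : ℕ} {a ε N : ℝ} (ha : 0 ≤ a) (hε : 0 < ε) (hε1 : ε ≤ 1)
    (hV : (V : ℝ) ≤ 1 / 16 * ((2 : ℝ) ^ a * ε ^ 2 / (a + 1))) (hN : (2 : ℝ) ^ a ≤ 2 * N) :
    (16 * V : ℝ) ^ (2 * V) * Real.exp (-(N * ε ^ 2 / 2)) < 1 := by
  have hMε : (2 : ℝ) ^ a * ε ^ 2 ≤ 2 ^ a :=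
    mul_le_of_le_one_right (by positivity) (pow_le_one₀ hε.le hε1)
  have hVa : 16 * V * (a + 1) ≤ (2 : ℝ) ^ a * ε ^ 2 := by
    rw [← le_div_iff₀ (by linarith)]
    linarith
  have hbase : (16 * V : ℝ) ≤ Real.exp a :=
    calc (16 * V : ℝ) ≤ 16 * V * (a + 1) := le_mul_of_one_le_right (by positivity) (by linarith)
      _ ≤ (2 : ℝ) ^ a := hVa.trans hMε
      _ ≤ Real.exp 1 ^ a :=
          Real.rpow_le_rpow zero_le_two (by linarith [Real.add_one_le_exp 1]) ha
      _ = Real.exp a := Real.exp_one_rpow a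
  have hNε : (2 : ℝ) ^ a * ε ^ 2 ≤ 2 * N * ε ^ 2 := by gcongr
  have hpos : 0 < (2 : ℝ) ^ a * ε ^ 2 := by positivity
  calc (16 * V : ℝ) ^ (2 * V) * Real.exp (-(N * ε ^ 2 / 2))
      ≤ Real.exp a ^ (2 * V) * Real.exp (-(N * ε ^ 2 / 2)) := by gcongr
    _ = Real.exp (2 * V * a - N * ε ^ 2 / 2) := by
        rw [← Real.exp_nat_mul, ← Real.exp_add]
        push_cast
        ring_nf
    _ < 1 := Real.exp_lt_one_iff.2 (by linarith [V.cast_nonneg (α := ℝ)])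

lemma two_rpow_mul_pow_four_div_le {a ε : ℝ} (hε : 0 < ε) (hε1 : ε ≤ 1)
    (ha : 2 ≤ (2 : ℝ) ^ a * ε ^ 2) :
    (2 : ℝ) ^ a * ε ^ 4 / (a * Real.logb 2 ((2 : ℝ) ^ a * ε ^ 2)) ≤
      2 * ((2 : ℝ) ^ a * ε ^ 2 / (a + 1)) := by
  have hε2 : ε ^ 2 ≤ 1 := pow_le_one₀ hε.le hε1
  have hlog : 1 ≤ Real.logb 2 ((2 : ℝ) ^ a * ε ^ 2) := by
    rwa [Real.le_logb_iff_rpow_le one_lt_two (by linarith), Real.rpow_one]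
  have ha1 : 1 ≤ a := by
    refine (Real.rpow_le_rpow_left_iff one_lt_two).1 ?_
    rw [Real.rpow_one]
    exact ha.trans (mul_le_of_le_one_right (by positivity) hε2)
  calc (2 : ℝ) ^ a * ε ^ 4 / (a * Real.logb 2 ((2 : ℝ) ^ a * ε ^ 2))
      ≤ (2 : ℝ) ^ a * ε ^ 2 / ((a + 1) / 2) := by
        gcongr ?_ / ?_
        · exact mul_le_mul_of_nonneg_left
            (pow_le_pow_of_le_one hε.le hε1 (by norm_num)) (by positivity)
        · exact (by linarith : (a + 1) / 2 ≤ a).trans (le_mul_of_one_le_right (by linarith) hlog)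
    _ = 2 * ((2 : ℝ) ^ a * ε ^ 2 / (a + 1)) := by field_simp

theorem mainTheorem2_general :
    ∃ c : ℝ, 0 < c ∧ ∀ (n m : ℕ) (k ε s : ℝ), 0 ≤ k → 0 < ε →
      (ε < 1 → s ≤ c * ((2 : ℝ) ^ (k + m) * ε ^ 2 / (k + m + 1))) →
      ∃ P : PMF (Bits n × Bits m),
        (∀ δ < 1, SmoothCondMinEntropyAtMost P δ (k - Real.logb 2 (1 - δ))) ∧
        MetricCondMinEntropyAtLeast P (realValuedCircuits n m s) ε n := by
  refine ⟨1 / 16, by norm_num, fun n m k ε s hk hε hs => ?_⟩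
  set K := ⌊(2 : ℝ) ^ k⌋₊
  have hK1 : 1 ≤ K := Nat.le_floor (by simpa using Real.one_le_rpow one_le_two hk)
  have hK : (K : ℝ) ≤ 2 ^ k := Nat.floor_le (by positivity)
  have hK2 : (2 : ℝ) ^ k ≤ 2 * K := by
    linarith [Nat.lt_floor_add_one ((2 : ℝ) ^ k), (by exact_mod_cast hK1 : (1 : ℝ) ≤ K)]
  have : NeZero K := ⟨by omega⟩
  obtain ⟨x, hx⟩ : ∃ x : Fin K × Bits m → Bits n, ∀ D ∈ realValuedCircuits n m s,
      |expect (sampleLaw x) D - expect (PMF.uniformOfFintype (Bits n × Bits m)) D| ≤ ε := by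
    rcases le_or_gt 1 ε with hε1 | hε1
    · exact ⟨fun _ _ => false, fun D hD =>
        (abs_expect_sub_le_one_of_mem_realValuedCircuits hD _ _).trans hε1⟩
    · refine exists_sampleLaw_forall_realValuedCircuits hε.le
        (pow_mul_exp_lt_one (a := k + m) (by positivity) hε hε1.le ?_ ?_)
      · exact (Nat.cast_le.2 (Nat.floor_le_floor (hs hε1))).trans (Nat.floor_le (by positivity))
      · rw [Real.rpow_add two_pos, Real.rpow_natCast]
        simpa [mul_assoc] using mul_le_mul_of_nonneg_right hK2 (by positivity : (0 : ℝ) ≤ 2 ^ m)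
  refine ⟨sampleLaw x, fun δ hδ => smoothCondMinEntropyAtMost_of_card_fiber_le (fun z => ?_) hδ,
    metricCondMinEntropyAtLeast_of_uniformOfFintype (condLaw_sampleLaw x) hx⟩
  exact (Nat.cast_le.2 (card_fiber_sampleLaw_le x z)).trans (by simpa using hK)

theorem mainTheorem2 :
    ∃ c : ℝ, 0 < c ∧ ∃ n₀ : ℕ, ∀ n : ℕ, n₀ ≤ n →
      ∀ (m : ℕ) (C k ε : ℝ), 0 < C → 0 ≤ k → k < n - C → 0 < ε →
        2 ≤ (2 : ℝ) ^ (k + m) * ε ^ 2 →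
        ∃ P : PMF (Bits n × Bits m),
          SmoothCondMinEntropyAtMost P (1 / 2) (k + 1) ∧
          MetricCondMinEntropyAtLeast P
            (realValuedCircuits n m
              (c * ((2 : ℝ) ^ (k + m) * ε ^ 4 /
                ((k + m) * Real.logb 2 ((2 : ℝ) ^ (k + m) * ε ^ 2)))))
            ε (k + C) := by
  obtain ⟨c, hc, hgeneral⟩ := mainTheorem2_general
  refine ⟨c / 2, half_pos hc, 0, fun n _ m C k ε _ hk hkn hε hMε => ?_⟩
  obtain ⟨P, hsmooth, hmetric⟩ := hgeneral n m k ε _ hk hε fun hε1 =>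
    calc c / 2 * _ ≤ c / 2 * _ :=
          mul_le_mul_of_nonneg_left (two_rpow_mul_pow_four_div_le hε hε1.le hMε) (half_pos hc).le
      _ = c * ((2 : ℝ) ^ (k + m) * ε ^ 2 / (k + m + 1)) := by ring
  refine ⟨P, ?_, hmetric.mono (by linarith)⟩
  convert hsmooth (1 / 2) (by norm_num) using 1
  norm_num [Real.logb_div]
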